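/- **Setting.** A quantum switch with $M$ memory registers serves $N$ users and $R$ requests $\mathcal R=\{1,\dots,R\}$; request $r$ is given by a set $\mathcal G(r)\subseteq\{1,\dots,N\}$ of users, distinct requests having distinct sets, with $\max_r|\mathcal G(r)|\le M<\sum_r|\mathcal G(r)|$. Let $\Lambda=\{|\mathcal G(r)|:r\in\mathcal R\}$ and $\mathcal C(\lambda)=\{r:|\mathcal G(r)|=\lambda\}$. In every slot $t=1,2,\dots$ a set $x(t)$ of requests is scheduled. For each scheduled request $r$, every user $i\in\mathcal G(r)$ establishes a link with probability $p_i\in(0,1]$, and if all of them do, an entanglement swap succeeds with probability $q_{|\mathcal G(r)|}\in(0,1]$; all these trials are independent of one another and of the past. A scheduled request is served in slot $t$ if all its links and its swap succeed; thus it is served with probability $q_{|\mathcal G(r)|}v(r)$, where $v(r)=\prod_{i\in\mathcal G(r)}p_i$. The age of $r$ at slot $t$ is $h_r(t)=t-\sup\{\tau\in\{1,\dots,t-1\}: r \text{ is served in slot } \tau\}$, with $\sup\emptyset=0$. The average age of $r$ is $\Delta_r=\limsup_{T\to\infty}\frac1T\sum_{t=1}^T\mathbb E[h_r(t)]$, and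 the overall average age is $\Delta=\frac1R\sum_{r}\Delta_r$. Let $n\ge1$ and let $\Lambda^{(1)},\dots,\Lambda^{(n)}\subseteq\Lambda$ be maximal feasible, i.e. $\sum_{\lambda\in\Lambda^{(i)}}\lambda\le M$ and $\sum_{\lambda\in\Lambda^{(i)}}\lambda+\lambda'>M$ for every $\lambda'\in\Lambda\setminus\Lambda^{(i)}$. A multi-cardinality max-age (MMA) policy with sampling distribution $\phi$ (a probability distribution on $[n]=\{1,\dots,n\}$) samples, in each slot, an index $j$ from $\phi$, independently of the past and of the trials of that slot, and schedules for each $\lambda\in\Lambda^{(j)}$ one request of $\mathcal C(\lambda)$ whose age is the largest in $\mathcal C(\lambda)$; ties are broken by an arbitrary rule that depends only on the past, the slot, $j$ and $\lambda$. **Proposition (optimal MMA sampling distribution).** Fix the switch and $\Lambda^{(1)},\dots,\Lambda^{(n)}$. Among all MMA policies (all sampling distributions and all tie-breaking rules) there is one that minimizes $\Delta$, and an MMA policy minimizes $\Delta$ if and only if its sampling distribution $\phi^\star$ satisfies $$\phi^\star\in\arg\min_{\phi}\ \sum_{\lambda\in\Lambda}\frac{1}{\sum_{i:\lambda\in\Lambda^{(i)}}\phi(i)}\,w_\lambda\qquad\text{s.t.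 } \phi(j)\ge0,\ \sum_{j\in[n]}\phi(j)=1,$$ where $1/0=\infty$ and $$w_\lambda=\frac{|\mathcal C(\lambda)|}{2q_\lambda}\Big(\frac1{\beta_\lambda}\sum_{r\in\mathcal C(\lambda)}\frac1{v(r)^2}+\beta_\lambda\Big),\qquad \beta_\lambda=\sum_{r\in\mathcal C(\lambda)}\frac1{v(r)}.$$ The same characterization holds, and the same policy can be taken as a minimizer, when $\Delta$ is replaced by $\limsup_{T\to\infty}\frac1{TR}\sum_{r}\sum_{t=1}^T\mathbb E[h_r(t)]$. -/

import Mathlib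

open MeasureTheory ProbabilityTheory Filter
open scoped ENNReal

/-- A quantum switch with `N` users, `R` requests and `M` memory registers. -/
structure QuantumSwitch (N R : ℕ) where
  /-- the set of users taking part in a request -/
  G : Fin R → Finset (Fin N)
  G_injective : Function.Injective G
  /-- the number of memory registers -/
  M : ℕ
  card_le_M : ∀ r, (G r).card ≤ M
  M_lt_sum : M < ∑ r, (G r).card
  /-- success probability of one link-level entanglement (LLE) attempt of a user -/
  p : Fin N → unitInterval
  p_pos : ∀ i, 0 < p i
  /-- success probability of entanglement swapping, as a function of the request's cardinality -/
  q : ℕ → unitInterval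
  q_pos : ∀ r, 0 < q (G r).card

namespace QuantumSwitch

variable {N R : ℕ} (S : QuantumSwitch N R)

/-- The set `Λ` of distinct request cardinalities. -/
def cards : Finset ℕ := Finset.univ.image fun r => (S.G r).card

/-- The set `C(lam)` of requests of cardinality `lam`. -/
def C (lam : ℕ) : Finset (Fin R) := Finset.univ.filter fun r => (S.G r).card = lam

/-- The probability `v(r)` that all users of `r` establish their LLEs. -/
noncomputable def v (r : Fin R) : ℝ := ∏ i ∈ S.G r, (S.p i : ℝ)

/-- `β_lam`, the sum of `1 / v(r)` over the requests of cardinality `lam`. -/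
noncomputable def β (lam : ℕ) : ℝ := ∑ r ∈ S.C lam, 1 / S.v r

/-- The weight `w_lam`. -/
noncomputable def w (lam : ℕ) : ℝ :=
  (S.C lam).card / (2 * (S.q lam : ℝ)) *
    ((1 / S.β lam) * (∑ r ∈ S.C lam, 1 / S.v r ^ 2) + S.β lam)

/-- `L` is a maximal feasible set of cardinalities. -/
def IsMaximalFeasible (L : Finset ℕ) : Prop :=
  L ⊆ S.cards ∧ (∑ lam ∈ L, lam) ≤ S.M ∧
    ∀ lam' ∈ S.cards \ L, S.M < (∑ lam ∈ L, lam) + lam'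

/-- The age of request `r` at slot `t`, given the record of the sets of requests served in each
slot: `t` minus the last slot in `{1, …, t - 1}` in which `r` was served (`0` if there is none). -/
def age (served : ℕ → Finset (Fin R)) (r : Fin R) (t : ℕ) : ℕ :=
  t - ((Finset.Ico 1 t).filter fun τ => r ∈ served τ).sup id

/-- The requests of cardinality `lam` whose age at slot `t` is the largest. -/
def oldest (served : ℕ → Finset (Fin R)) (t lam : ℕ) : Finset (Fin R) :=
  (S.C lam).filter fun r => ∀ r' ∈ S.C lam, age served r' t ≤ age served r t

end QuantumSwitch

/-- The randomness of one slot: the sampled index, the outcomes of the LLE attempts (one for each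
request and user), and the outcomes of the entanglement swaps (one for each request). -/
abbrev SlotNoise (N R n : ℕ) : Type :=
  Fin n × (Fin R → Fin N → Bool) × (Fin R → Bool)

/-- The requests that are actually served when the memory configuration is `x` and the randomness
of the slot is `z`: those in `x` all of whose users establish their LLE and whose swap succeeds. -/
def QuantumSwitch.serve {N R n : ℕ} (S : QuantumSwitch N R) (x : Finset (Fin R))
    (z : SlotNoise N R n) : Finset (Fin R) :=
  x.filter fun r => (∀ i ∈ S.G r, z.2.1 r i = true) ∧ z.2.2 r = true

/-- A multi-cardinality max-age policy for the cardinality subsets `Λ^(1), …, Λ^(n)`: a sampling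
distribution on the indices, together with a rule that breaks the ties in the choice of a request
of largest age. The rule is arbitrary but causal: it may use the slot, the whole past, the sampled
index and the cardinality at hand. (The randomness with number `0` precedes slot `1`, is used by
no slot, and is at the rule's disposal as well.) -/
structure MMAPolicy (N R n : ℕ) where
  /-- the sampling distribution -/
  φ : PMF (Fin n)
  /-- the element that is picked out of a set of tied requests -/
  pick : (t : ℕ) → (Fin t → SlotNoise N R n) → Fin n → ℕ → Finset (Fin R) → Fin R
  pick_mem : ∀ t past j lam A, A.Nonempty → pick t past j lam A ∈ A

namespace MMAPolicy

variable {N R n : ℕ} (S : QuantumSwitch N R) (L : Fin n → Finset ℕ) (π : MMAPolicy N R n)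

/-- The memory configuration of slot `t`, given the record of the requests served before `t`, when
`ω` is the randomness: one request of largest age for each cardinality in the sampled subset. -/
def configOf (ω : ℕ → SlotNoise N R n) (t : ℕ) (served : ℕ → Finset (Fin R)) : Finset (Fin R) :=
  (L (ω t).1).image fun lam =>
    π.pick t (fun s => ω s) (ω t).1 lam (S.oldest served t lam)

/-- The set of requests served in slot `t`, as a function of the randomness `ω`. Slots are numbered
from `1` on: what is computed for slot `0` enters no age. -/
def served (ω : ℕ → SlotNoise N R n) (t : ℕ) : Finset (Fin R) :=
  S.serve (π.configOf S L ω t fun τ => if _h : τ < t then served ω τ else ∅) (ω t)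
termination_by t

/-- The age of request `r` at slot `t` under the policy. -/
def h (r : Fin R) (t : ℕ) (ω : ℕ → SlotNoise N R n) : ℕ :=
  QuantumSwitch.age (π.served S L ω) r t

/-- The memory configuration of slot `t` under the policy. -/
def config (t : ℕ) (ω : ℕ → SlotNoise N R n) : Finset (Fin R) :=
  π.configOf S L ω t (π.served S L ω)

/-- The age looks only at the slots before `t`, so that `served` satisfies the expected dynamics:
the requests served in slot `t` are those in the configuration of slot `t` that succeed. -/
theorem served_eq (ω : ℕ → SlotNoise N R n) (t : ℕ) :
    π.served S L ω t = S.serve (π.config S L t ω) (ω t) := by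
  have key : ∀ r, QuantumSwitch.age
      (fun τ => if _h : τ < t then π.served S L ω τ else ∅) r t
      = QuantumSwitch.age (π.served S L ω) r t := by
    intro r
    unfold QuantumSwitch.age
    congr 2
    apply Finset.filter_congr
    intro τ hτ
    simp [(Finset.mem_Ico.mp hτ).2]
  rw [served]
  simp only [config, configOf, QuantumSwitch.oldest, key]

/-- The law of the randomness of one slot: the index has law `φ`, user `i` succeeds with
probability `p i` in each LLE attempt, the swap of `r` succeeds with probability `q` of the
cardinality of `r`, and everything is independent. -/
noncomputable def slotLaw : Measure (SlotNoise N R n) :=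
  π.φ.toMeasure.prod
    ((Measure.pi fun _ : Fin R => Measure.pi fun i : Fin N => bernoulliMeasure true false (S.p i)).prod
      (Measure.pi fun r : Fin R => bernoulliMeasure true false (S.q (S.G r).card)))

/-- The law of the randomness of all slots: independent copies of `slotLaw`. -/
noncomputable def law : Measure (ℕ → SlotNoise N R n) :=
  Measure.infinitePi fun _ => π.slotLaw S

/-- The expected age of request `r` at slot `t`. -/
noncomputable def expectedAge (r : Fin R) (t : ℕ) : ℝ≥0∞ :=
  ∫⁻ ω, (π.h S L r t ω : ℝ≥0∞) ∂(π.law S)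

/-- The long-term average age of request `r`. -/
noncomputable def avgAge (r : Fin R) : ℝ≥0∞ :=
  limsup (fun T : ℕ => (∑ t ∈ Finset.Icc 1 T, π.expectedAge S L r t) / (T : ℝ≥0∞)) atTop

/-- The overall average age: the mean over the requests of their long-term average ages. -/
noncomputable def overallAge : ℝ≥0∞ := (∑ r, π.avgAge S L r) / (R : ℝ≥0∞)

/-- The objective of the scheduling problem: the long-term average of the mean age. -/
noncomputable def jointAge : ℝ≥0∞ :=
  limsup (fun T : ℕ => (∑ r, ∑ t ∈ Finset.Icc 1 T, π.expectedAge S L r t) /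
    ((T : ℝ≥0∞) * (R : ℝ≥0∞))) atTop

/-- The policy has the least overall average age among all policies of the class. -/
def IsOptimal : Prop := ∀ π' : MMAPolicy N R n, π.overallAge S L ≤ π'.overallAge S L

/-- The policy has the least long-term average of the mean age among all policies of the class. -/
def IsJointlyOptimal : Prop := ∀ π' : MMAPolicy N R n, π.jointAge S L ≤ π'.jointAge S L

end MMAPolicy

/-- The objective function on the probability simplex: the sum over the cardinalities of `w_lam`
divided by the probability of the indices whose subset contains `lam` (with `1 / 0 = ∞`). -/
noncomputable def samplingObjective {N R n : ℕ} (S : QuantumSwitch N R) (L : Fin n → Finset ℕ)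
    (φ : PMF (Fin n)) : ℝ≥0∞ :=
  ∑ lam ∈ S.cards, (1 / (∑ i with lam ∈ L i, φ i)) * ENNReal.ofReal (S.w lam)

/-- `φ` minimizes the objective over the probability simplex. -/
def IsSamplingMinimizer {N R n : ℕ} (S : QuantumSwitch N R) (L : Fin n → Finset ℕ)
    (φ : PMF (Fin n)) : Prop :=
  ∀ φ' : PMF (Fin n), samplingObjective S L φ ≤ samplingObjective S L φ'

/-! ### Causality: what is scheduled depends on the past alone -/

namespace QuantumSwitch

variable {N R : ℕ} (S : QuantumSwitch N R)

/-! The proof computes the average age of every MMA policy exactly: it is `samplingObjective` at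
`φ`, divided by `R`, whatever the tie-breaking rule. Optimal policies are then those whose `φ`
minimizes the objective, and a minimizer exists because the simplex is compact.

Fix a cardinality `lam`, sampled with probability `s > 0` per slot. Once every request of `C lam`
has been served, max-age scheduling is round robin: the request in turn is `i` until it succeeds,
which takes a geometric time of mean `y i = 1 / (s * q * v i)`. The time-average age of each request
is then `meanAge = (∑ y) / 2 + (∑ y ^ 2) / (2 * ∑ y)`, and `|C lam|` times this is `w lam / s`
(`meanAge_serviceTime`).

The average is obtained from a Poisson equation rather than from renewal theory. `potential` is an
explicit function of the age of `r` and of the set of requests at least as old as `r`; its expected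
one-slot increment is `meanAge` minus the age, except while some request has never been served
(`abs_integral_potential_step_le`). A Lyapunov function bounds the total of these errors
(`sum_initial_le`), and telescoping yields the limit (`tendsto_average_of_poisson`). If `s = 0`, the
expected age at slot `t` is `t`, and the average is infinite, in agreement with `1 / 0 = ∞`. -/

theorem age_congr {x y : ℕ → Finset (Fin R)} {t : ℕ} (h : ∀ τ < t, x τ = y τ) (r : Fin R) :
    age x r t = age y r t := by
  unfold age
  congr 2
  apply Finset.filter_congr
  intro τ hτ
  rw [h τ (Finset.mem_Ico.mp hτ).2]

theorem oldest_congr {x y : ℕ → Finset (Fin R)} {t : ℕ} (h : ∀ τ < t, x τ = y τ) (lam : ℕ) :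
    S.oldest x t lam = S.oldest y t lam := by
  simp only [oldest, age_congr h]

theorem oldest_nonempty (x : ℕ → Finset (Fin R)) (t : ℕ) {lam : ℕ} (hlam : lam ∈ S.cards) :
    (S.oldest x t lam).Nonempty := by
  obtain ⟨r, -, hr⟩ := Finset.mem_image.mp hlam
  obtain ⟨i, hi, him⟩ := Finset.exists_max_image (S.C lam) (fun i => age x i t)
    ⟨r, by simp [C, hr]⟩
  exact ⟨i, Finset.mem_filter.mpr ⟨hi, him⟩⟩

/-- The randomness `z` of the slot samples the index `j`, and all trials of request `r` succeed. -/
def Succeeds {n : ℕ} (r : Fin R) (j : Fin n) (z : SlotNoise N R n) : Prop :=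
  z.1 = j ∧ (∀ i ∈ S.G r, z.2.1 r i = true) ∧ z.2.2 r = true

instance {n : ℕ} (r : Fin R) (j : Fin n) : DecidablePred (S.Succeeds (n := n) r j) :=
  fun _ => inferInstanceAs (Decidable (_ ∧ _))

end QuantumSwitch

namespace MMAPolicy

variable {N R n : ℕ} (S : QuantumSwitch N R) (L : Fin n → Finset ℕ) (π : MMAPolicy N R n)

theorem served_dependsOn (t : ℕ) : DependsOn (fun ω => π.served S L ω t) (Set.Iio (t + 1)) := by
  induction t using Nat.strong_induction_on with
  | _ t ih =>
    intro ω ω' hω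
    have hs : ∀ τ < t, π.served S L ω τ = π.served S L ω' τ := fun τ hτ =>
      ih τ hτ fun s hs => hω s (by simp only [Set.mem_Iio] at hs ⊢; omega)
    have ht : ω t = ω' t := hω t (by simp)
    have hp : (fun s : Fin t => ω s) = fun s : Fin t => ω' s :=
      funext fun s => hω s (by have := s.2; simp only [Set.mem_Iio]; omega)
    simp only [served_eq, config, configOf, S.oldest_congr hs, ht, hp]

theorem h_dependsOn (r : Fin R) (t : ℕ) : DependsOn (π.h S L r t) (Set.Iio t) :=
  fun _ _ hω => QuantumSwitch.age_congr (fun τ hτ => π.served_dependsOn S L τ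
    fun s hs => hω s (by simp only [Set.mem_Iio] at hs ⊢; omega)) r

/-- The request of cardinality `lam` that is scheduled in slot `t` when `j` is sampled. -/
def candidate (lam t : ℕ) (j : Fin n) (ω : ℕ → SlotNoise N R n) : Fin R :=
  π.pick t (fun s => ω s) j lam (S.oldest (π.served S L ω) t lam)

theorem candidate_dependsOn (lam t : ℕ) (j : Fin n) :
    DependsOn (π.candidate S L lam t j) (Set.Iio t) := by
  intro ω ω' hω
  have hs : ∀ τ < t, π.served S L ω τ = π.served S L ω' τ := fun τ hτ =>
    π.served_dependsOn S L τ fun s hs => hω s (by simp only [Set.mem_Iio] at hs ⊢; omega)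
  have hp : (fun s : Fin t => ω s) = fun s : Fin t => ω' s :=
    funext fun s => hω s s.2
  simp only [candidate, S.oldest_congr hs, hp]

theorem candidate_mem_oldest {lam : ℕ} (hlam : lam ∈ S.cards) (t : ℕ) (j : Fin n)
    (ω : ℕ → SlotNoise N R n) :
    π.candidate S L lam t j ω ∈ S.oldest (π.served S L ω) t lam :=
  π.pick_mem _ _ _ _ _ (S.oldest_nonempty _ _ hlam)

theorem candidate_mem_C {lam : ℕ} (hlam : lam ∈ S.cards) (t : ℕ) (j : Fin n)
    (ω : ℕ → SlotNoise N R n) : π.candidate S L lam t j ω ∈ S.C lam :=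
  (Finset.mem_filter.mp (π.candidate_mem_oldest S L hlam t j ω)).1

variable {L} in
-- Candidates for different cardinalities lie in disjoint classes, so `i` can only have been
-- scheduled as the candidate for its own cardinality.
theorem mem_served_iff (hL : ∀ j, L j ⊆ S.cards) {lam t : ℕ} {i : Fin R} (hi : i ∈ S.C lam)
    (ω : ℕ → SlotNoise N R n) :
    i ∈ π.served S L ω t ↔ lam ∈ L (ω t).1 ∧ π.candidate S L lam t (ω t).1 ω = i ∧
      S.Succeeds i (ω t).1 (ω t) := by
  have hcard : (S.G i).card = lam := by simpa [QuantumSwitch.C] using hi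
  rw [served_eq]
  simp only [QuantumSwitch.serve, config, configOf, Finset.mem_filter, Finset.mem_image,
    QuantumSwitch.Succeeds, true_and]
  constructor
  · rintro ⟨⟨lam', hlam', rfl⟩, h⟩
    have : lam' = lam := by
      have := π.candidate_mem_C S L (hL _ hlam') t (ω t).1 ω
      rw [← hcard]
      simpa [QuantumSwitch.C, candidate, eq_comm] using this
    subst this
    exact ⟨hlam', rfl, h⟩
  · rintro ⟨h1, h2, h3⟩
    exact ⟨⟨lam, h1, h2⟩, h3⟩

/-! ### Expectations over one slot -/

instance : IsProbabilityMeasure (π.slotLaw S) := by unfold slotLaw; infer_instance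

instance : IsProbabilityMeasure (π.law S) := by unfold law; infer_instance

theorem slotLaw_succeeds (r : Fin R) (j : Fin n) :
    (π.slotLaw S).real {z | S.Succeeds r j z} =
      (π.φ j).toReal * (S.q (S.G r).card * S.v r) := by
  -- The event is a product set: it constrains only the index, the links of `r` to its own users,
  -- and the swap of `r`.
  have hset : {z : SlotNoise N R n | S.Succeeds r j z} =
      {j} ×ˢ ((Set.univ.pi fun r' => if r' = r then
        Set.univ.pi fun i => if i ∈ S.G r then {true} else Set.univ else Set.univ) ×ˢ
        (Set.univ.pi fun r' => if r' = r then {true} else Set.univ)) := by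
    ext ⟨a, b, c⟩
    simp only [QuantumSwitch.Succeeds, Set.mem_ofPred_eq, Set.mem_prod, Set.mem_singleton_iff,
      Set.mem_pi, Set.mem_univ, true_implies]
    refine and_congr_right fun _ => and_congr ?_ ?_
    · constructor
      · intro h r'
        split_ifs with hr
        · subst hr
          intro i _
          by_cases hi : i ∈ S.G r' <;> simp [hi, h]
        · trivial
      · intro h i hi
        have := h r
        rw [if_pos rfl] at this
        simpa [hi] using this i (Set.mem_univ i)
    · constructor
      · intro h r'
        split_ifs with hr
        · subst hr; exact h
        · trivial
      · intro h
        simpa using h r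
  rw [hset, slotLaw, measureReal_prod_prod, measureReal_prod_prod, measureReal_def,
    measureReal_def, measureReal_def, PMF.toMeasure_apply_singleton _ _ (MeasurableSet.of_discrete),
    Measure.pi_pi, Measure.pi_pi, Finset.prod_eq_single r, Finset.prod_eq_single r]
  · rw [if_pos rfl, if_pos rfl, Measure.pi_pi, ENNReal.toReal_prod, ← measureReal_def,
      bernoulliMeasure_real_apply_of_mem_of_notMem _ MeasurableSet.of_discrete (by simp) (by simp),
      mul_comm (S.q _ : ℝ)]
    congr 2
    rw [QuantumSwitch.v, ← Finset.prod_subset (Finset.subset_univ (S.G r))]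
    · refine Finset.prod_congr rfl fun i hi => ?_
      rw [if_pos hi, ← measureReal_def,
        bernoulliMeasure_real_apply_of_mem_of_notMem _ MeasurableSet.of_discrete
          (by simp) (by simp)]
    · intro i _ hi
      simp [hi]
  all_goals simp +contextual

theorem exists_eq_comp_of_dependsOn {t : ℕ} {X : (ℕ → SlotNoise N R n) → ℝ}
    (hX : DependsOn X (Set.Iio t)) :
    ∃ g : ((s : Finset.range t) → SlotNoise N R n) → ℝ, X = g ∘ (Finset.range t).restrict := by
  rw [← Finset.coe_range] at hX
  exact dependsOn_iff_exists_comp.mp hX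

/-- A function of finitely many slots takes finitely many values, since the noise of a slot ranges
over a finite type. -/
theorem integrable_of_dependsOn {t : ℕ} {X : (ℕ → SlotNoise N R n) → ℝ}
    (hX : DependsOn X (Set.Iio t)) : Integrable X (π.law S) := by
  obtain ⟨g, rfl⟩ := exists_eq_comp_of_dependsOn hX
  exact Integrable.of_finite.comp_measurable (Finset.measurable_restrict _)

theorem integral_mul_of_dependsOn {t : ℕ} {X : (ℕ → SlotNoise N R n) → ℝ}
    (hX : DependsOn X (Set.Iio t)) (Y : SlotNoise N R n → ℝ) :
    ∫ ω, X ω * Y (ω t) ∂(π.law S) = (∫ ω, X ω ∂(π.law S)) * ∫ z, Y z ∂(π.slotLaw S) := by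
  obtain ⟨g, rfl⟩ := exists_eq_comp_of_dependsOn hX
  have hind : iIndepFun (fun (s : ℕ) (ω : ℕ → SlotNoise N R n) => ω s) (π.law S) :=
    iIndepFun_infinitePi (P := fun _ : ℕ => π.slotLaw S) (X := fun _ z => z)
      (fun _ => measurable_id)
  have hind2 := (hind.indepFun_finset (Finset.range t) {t} (by simp)
    (fun s => measurable_pi_apply s)).comp (φ := g) (ψ := fun z => Y (z ⟨t, by simp⟩))
    (measurable_of_countable _) (measurable_of_countable _)
  have h1 := hind2.integral_fun_mul_eq_mul_integral
    ((measurable_of_countable g).comp (Finset.measurable_restrict _)).aestronglyMeasurable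
    ((measurable_of_countable Y).comp (measurable_pi_apply t)).aestronglyMeasurable
  refine h1.trans ?_
  congr 1
  rw [← (measurePreserving_eval_infinitePi (fun _ : ℕ => π.slotLaw S) t).map_eq,
    integral_map (measurable_pi_apply t).aemeasurable
      (measurable_of_countable Y).aestronglyMeasurable]
  rfl

variable {L} in
/-- The expectation after one slot of a quantity that changes by `D i` when request `i` of
cardinality `lam` is served, in terms of the past. -/
theorem integral_step (hL : ∀ j, L j ⊆ S.cards) {lam t : ℕ} (hlam : lam ∈ S.cards)
    {a : (ℕ → SlotNoise N R n) → ℝ} {D : Fin R → (ℕ → SlotNoise N R n) → ℝ}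
    (ha : DependsOn a (Set.Iio t)) (hD : ∀ i, DependsOn (D i) (Set.Iio t)) :
    ∫ ω, (a ω + ∑ i ∈ S.C lam, if i ∈ π.served S L ω t then D i ω else 0) ∂(π.law S) =
      ∫ ω, (a ω + ∑ j with lam ∈ L j, (π.φ j).toReal *
        (S.q lam * S.v (π.candidate S L lam t j ω) *
          D (π.candidate S L lam t j ω) ω)) ∂(π.law S) := by
  have hterm : ∀ i j, DependsOn (fun ω => if π.candidate S L lam t j ω = i then D i ω else 0)
      (Set.Iio t) := by
    intro i j ω ω' hω
    simp only [π.candidate_dependsOn S L lam t j hω, hD i hω]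
  -- Splitting over the value `j` of the sampled index separates the past, which fixes the candidate
  -- for `j`, from the noise of slot `t`, which decides `Succeeds i j`.
  have hlhs : ∀ ω, (∑ i ∈ S.C lam, if i ∈ π.served S L ω t then D i ω else 0) =
      ∑ j with lam ∈ L j, ∑ i ∈ S.C lam, (if π.candidate S L lam t j ω = i then D i ω else 0) *
        (if S.Succeeds i j (ω t) then 1 else 0) := by
    intro ω
    rw [Finset.sum_comm]
    refine Finset.sum_congr rfl fun i hi => ?_
    rw [Finset.sum_filter, Finset.sum_eq_single (ω t).1]
    · have := π.mem_served_iff S hL hi ω (t := t)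
      by_cases h1 : lam ∈ L (ω t).1 <;> by_cases h2 : π.candidate S L lam t (ω t).1 ω = i <;>
        by_cases h3 : S.Succeeds i (ω t).1 (ω t) <;> simp [this, h1, h2, h3]
    · intro j _ hj
      have : ¬ S.Succeeds i j (ω t) := fun h => hj h.1.symm
      simp [this]
    · simp
  have hsum : ∀ (ω : ℕ → SlotNoise N R n) (j : Fin n),
      (π.φ j).toReal *
        (S.q lam * S.v (π.candidate S L lam t j ω) * D (π.candidate S L lam t j ω) ω) =
      ∑ i ∈ S.C lam, (if π.candidate S L lam t j ω = i then D i ω else 0) *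
        ((π.φ j).toReal * (S.q lam * S.v i)) := by
    intro ω j
    rw [Finset.sum_eq_single (π.candidate S L lam t j ω)]
    · rw [if_pos rfl]; ring
    · intro i _ hi
      rw [if_neg hi.symm, zero_mul]
    · exact fun h => absurd (π.candidate_mem_C S L hlam t j ω) h
  have hY : ∀ i ∈ S.C lam, ∀ j, ∫ z, (if S.Succeeds i j z then (1 : ℝ) else 0) ∂(π.slotLaw S) =
      (π.φ j).toReal * (S.q lam * S.v i) := by
    intro i hi j
    have hcard : (S.G i).card = lam := by simpa [QuantumSwitch.C] using hi
    rw [← hcard, ← π.slotLaw_succeeds S i j, ← integral_indicator_one MeasurableSet.of_discrete]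
    simp [Set.indicator_apply]
  have hint : ∀ i j, Integrable (fun ω => (if π.candidate S L lam t j ω = i then D i ω else 0) *
      (if S.Succeeds i j (ω t) then 1 else 0)) (π.law S) := fun i j =>
    π.integrable_of_dependsOn S (t := t + 1) fun ω ω' hω => by
      simp only [hterm i j (fun s hs => hω s (Set.Iio_subset_Iio (Nat.le_succ t) hs)),
        hω t (Set.mem_Iio.mpr (Nat.lt_succ_self t))]
  have hint' : ∀ i j, Integrable (fun ω => (if π.candidate S L lam t j ω = i then D i ω else 0) *
      ((π.φ j).toReal * (S.q lam * S.v i))) (π.law S) := fun i j =>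
    (π.integrable_of_dependsOn S (hterm i j)).mul_const _
  have haint := π.integrable_of_dependsOn S ha
  simp_rw [hlhs, hsum]
  rw [integral_add haint (integrable_finsetSum _ fun j _ => integrable_finsetSum _ fun i _ =>
      hint i j), integral_add haint (integrable_finsetSum _ fun j _ =>
      integrable_finsetSum _ fun i _ => hint' i j),
    integral_finsetSum _ (fun j _ => integrable_finsetSum _ fun i _ => hint i j),
    integral_finsetSum _ (fun j _ => integrable_finsetSum _ fun i _ => hint' i j)]
  congr 1
  refine Finset.sum_congr rfl fun j _ => ?_
  rw [integral_finsetSum _ (fun i _ => hint i j), integral_finsetSum _ (fun i _ => hint' i j)]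
  refine Finset.sum_congr rfl fun i hi => ?_
  rw [π.integral_mul_of_dependsOn S (hterm i j) (fun z => if S.Succeeds i j z then 1 else 0),
    hY i hi j, integral_mul_const]

end MMAPolicy

/-! ### Recursion for the ages, and ties -/

namespace QuantumSwitch

section Age

variable {R : ℕ} (x : ℕ → Finset (Fin R)) (r : Fin R)

theorem age_one : age x r 1 = 1 := by simp [age]

theorem age_le (t : ℕ) : age x r t ≤ t := Nat.sub_le _ _

theorem sup_served_lt {t : ℕ} (ht : 1 ≤ t) :
    ((Finset.Ico 1 t).filter fun τ => r ∈ x τ).sup id < t := by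
  rw [Finset.sup_lt_iff (Nat.lt_of_succ_le ht)]
  intro τ hτ
  exact (Finset.mem_Ico.mp (Finset.mem_filter.mp hτ).1).2

theorem one_le_age {t : ℕ} (ht : 1 ≤ t) : 1 ≤ age x r t := by
  have := sup_served_lt x r ht
  unfold age
  omega

theorem age_succ {t : ℕ} (ht : 1 ≤ t) :
    age x r (t + 1) = if r ∈ x t then 1 else age x r t + 1 := by
  have hlt := sup_served_lt x r ht
  unfold age
  rw [← Finset.insert_Ico_right_eq_Ico_add_one ht, Finset.filter_insert]
  split_ifs with h
  · rw [Finset.sup_insert, id, sup_eq_left.mpr hlt.le]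
    omega
  · omega

/-- Two requests of the same age have never been served, as long as at most one request of the
class is served in each slot. -/
theorem age_eq_of_tie {C : Finset (Fin R)}
    (hx : ∀ t, ∀ i ∈ C, ∀ k ∈ C, i ∈ x t → k ∈ x t → i = k) {t : ℕ} (ht : 1 ≤ t)
    {i k : Fin R} (hi : i ∈ C) (hk : k ∈ C) (hik : i ≠ k) (h : age x i t = age x k t) :
    age x i t = t := by
  induction t, ht using Nat.le_induction with
  | base => exact age_one x i
  | succ t ht ih =>
    rw [age_succ x i ht, age_succ x k ht] at h
    have h1 := one_le_age x i ht
    have h2 := one_le_age x k ht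
    rw [age_succ x i ht]
    -- A request just served has age 1 and any other has age at least 2, so a tie between distinct
    -- requests means that neither was served and that they were tied before.
    split_ifs at h ⊢ with h3 h4 h4
    · exact absurd (hx t i hi k hk h3 h4) hik
    · omega
    · omega
    · rw [ih (by omega)]

end Age

end QuantumSwitch

/-! ### Poisson equation for cyclic service -/

namespace CyclicService

variable {ι : Type*} (C : Finset ι) (y : ι → ℝ)

/-- The elements of `C` that are served no later than `r` when the ages are `a`. -/
def ahead (a : ι → ℕ) (r : ι) : Finset ι := C.filter fun i => a r ≤ a i

/-- The long-term average age of an element of `C` when the elements are served in cyclic order,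
with independent geometric service times of means `y i`. -/
noncomputable def meanAge : ℝ := (∑ i ∈ C, y i) / 2 + (∑ i ∈ C, y i ^ 2) / (2 * ∑ i ∈ C, y i)

/-- The part of the potential that depends only on the set of elements ahead. -/
noncomputable def queueCost (Q : Finset ι) : ℝ :=
  (∑ i ∈ Q, y i) ^ 2 / 2 + (∑ i ∈ Q, y i ^ 2) / 2 - (1 + meanAge C y) * ∑ i ∈ Q, y i

/-- The solution of the Poisson equation for the age of `r`. -/
noncomputable def potential (A : ℕ) (Q : Finset ι) : ℝ := A * ∑ i ∈ Q, y i + queueCost C y Q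

@[simp] theorem potential_empty (A : ℕ) : potential C y A ∅ = 0 := by
  simp [potential, queueCost]

/-- This normalization singles out the constant `meanAge`. Serving `r` resets its age to 1 and puts
everyone ahead of it; the potential there must agree with its value on the empty queue, which is
what erasing `r` from `{r}` gives. -/
theorem potential_one_self (hC : ∑ i ∈ C, y i ≠ 0) : potential C y 1 C = 0 := by
  unfold potential queueCost meanAge
  field_simp
  push_cast
  ring

/-- The quadratic terms of `queueCost` are chosen so that `y i ^ 2` cancels. The drop is then `y i`
times a factor that does not depend on `i`, and a service rate of `1 / y i` makes the drift
independent of who is in turn. -/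
theorem potential_erase_sub [DecidableEq ι] {A : ℕ} {Q : Finset ι} {i : ι} (hi : i ∈ Q) :
    potential C y A (Q.erase i) - potential C y A Q =
      -(y i * (A - 1 + ∑ k ∈ Q, y k - meanAge C y)) := by
  have h1 := Finset.add_sum_erase Q y hi
  have h2 := Finset.add_sum_erase Q (fun k => y k ^ 2) hi
  unfold potential queueCost
  rw [← h1, ← h2]
  ring

/-- The change of the potential of `r`, beyond the growth of its age, when `i` is served. -/
noncomputable def jump [DecidableEq ι] (A : ℕ) (Q : Finset ι) (r i : ι) : ℝ :=
  (if i = r then 0 else potential C y (A + 1) (Q.erase i)) - potential C y (A + 1) Q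

/-- Serving `r` makes it the youngest, with everyone ahead; serving another element removes it from
those ahead of `r`; without a service the order of the ages is unchanged. -/
theorem potential_step [DecidableEq ι] (hC : ∑ i ∈ C, y i ≠ 0) {a a' : ι → ℕ} {x : Finset ι}
    {r : ι} (hr : r ∈ C) (ha : ∀ i ∈ C, 1 ≤ a i) (ha' : ∀ i ∈ C, a' i = if i ∈ x then 1 else a i + 1)
    (hx : ∀ i ∈ C, ∀ k ∈ C, i ∈ x → k ∈ x → i = k) :
    potential C y (a' r) (ahead C a' r) = potential C y (a r + 1) (ahead C a r) +
      ∑ i ∈ C, if i ∈ x then jump C y (a r) (ahead C a r) r i else 0 := by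
  by_cases h : ∃ k ∈ C, k ∈ x
  · obtain ⟨k, hk, hkx⟩ := h
    have hiff : ∀ i ∈ C, (i ∈ x ↔ k = i) :=
      fun i hi => ⟨fun h => hx k hk i hi hkx h, fun h => h ▸ hkx⟩
    rw [Finset.sum_congr rfl fun i hi => by rw [if_congr (hiff i hi) rfl rfl], Finset.sum_ite_eq,
      if_pos hk, jump, add_sub_cancel]
    have ha'' : ∀ i ∈ C, a' i = if k = i then 1 else a i + 1 := fun i hi => by
      rw [ha' i hi, if_congr (hiff i hi) rfl rfl]
    by_cases hkr : k = r
    · have hQ : ahead C a' r = C := by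
        refine Finset.filter_true_of_mem fun i hi => ?_
        rw [ha'' r hr, ha'' i hi, if_pos hkr]
        split_ifs <;> omega
      rw [if_pos hkr, hQ, ha'' r hr, if_pos hkr, potential_one_self C y hC]
    · have hQ : ahead C a' r = (ahead C a r).erase k := by
        ext i
        simp only [ahead, Finset.mem_filter, Finset.mem_erase]
        by_cases hi : i ∈ C
        · rw [ha'' r hr, ha'' i hi, if_neg hkr]
          have := ha r hr
          by_cases hki : k = i
          · subst hki; simp; omega
          · simp [hki, Ne.symm hki]
        · simp [hi]
      rw [if_neg hkr, hQ, ha'' r hr, if_neg hkr]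
  · push Not at h
    rw [Finset.sum_eq_zero fun i hi => if_neg (h i hi), add_zero]
    have ha'' : ∀ i ∈ C, a' i = a i + 1 := fun i hi => by rw [ha' i hi, if_neg (h i hi)]
    have hQ : ahead C a' r = ahead C a r := by
      refine Finset.filter_congr fun i hi => ?_
      rw [ha'' r hr, ha'' i hi, Nat.add_le_add_iff_right]
    rw [hQ, ha'' r hr]

theorem mem_ahead {a : ι → ℕ} {r i : ι} : i ∈ ahead C a r ↔ i ∈ C ∧ a r ≤ a i :=
  Finset.mem_filter

theorem jump_of_ne [DecidableEq ι] {A : ℕ} {Q : Finset ι} {r i : ι} (hi : i ∈ Q) (hir : i ≠ r) :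
    jump C y A Q r i = -(y i * (A + ∑ k ∈ Q, y k - meanAge C y)) := by
  rw [jump, if_neg hir, potential_erase_sub C y hi]
  push_cast
  ring

theorem jump_self [DecidableEq ι] {A : ℕ} {Q : Finset ι} {r : ι} (hr : r ∈ Q) :
    jump C y A Q r r = -(y r * (A + ∑ k ∈ Q, y k - meanAge C y)) -
      potential C y (A + 1) (Q.erase r) := by
  have := potential_erase_sub C y (A := A + 1) hr
  rw [jump, if_pos rfl]
  push_cast at this
  linear_combination this

/-- A bound for `queueCost`. -/
noncomputable def costBound : ℝ :=
  (∑ i ∈ C, y i) ^ 2 / 2 + (∑ i ∈ C, y i ^ 2) / 2 + (1 + meanAge C y) * ∑ i ∈ C, y i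

variable {C y}

theorem meanAge_nonneg (hy : ∀ i ∈ C, 0 ≤ y i) : 0 ≤ meanAge C y := by
  have h1 : 0 ≤ ∑ i ∈ C, y i := Finset.sum_nonneg hy
  have h2 : 0 ≤ ∑ i ∈ C, y i ^ 2 := Finset.sum_nonneg fun i _ => sq_nonneg _
  unfold meanAge
  positivity

theorem abs_queueCost_le (hy : ∀ i ∈ C, 0 ≤ y i) {Q : Finset ι} (hQ : Q ⊆ C) :
    |queueCost C y Q| ≤ costBound C y := by
  have h1 : ∑ i ∈ Q, y i ≤ ∑ i ∈ C, y i :=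
    Finset.sum_le_sum_of_subset_of_nonneg hQ fun i hi _ => hy i hi
  have h2 : ∑ i ∈ Q, y i ^ 2 ≤ ∑ i ∈ C, y i ^ 2 :=
    Finset.sum_le_sum_of_subset_of_nonneg hQ fun i _ _ => sq_nonneg _
  have h3 : 0 ≤ ∑ i ∈ Q, y i := Finset.sum_nonneg fun i hi => hy i (hQ hi)
  have h4 : 0 ≤ ∑ i ∈ Q, y i ^ 2 := Finset.sum_nonneg fun i _ => sq_nonneg _
  have h5 := meanAge_nonneg hy
  have h6 : (∑ i ∈ Q, y i) ^ 2 ≤ (∑ i ∈ C, y i) ^ 2 := by gcongr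
  have h7 : (1 + meanAge C y) * ∑ i ∈ Q, y i ≤ (1 + meanAge C y) * ∑ i ∈ C, y i := by gcongr
  have h8 : 0 ≤ (1 + meanAge C y) * ∑ i ∈ Q, y i := by positivity
  have h9 := sq_nonneg (∑ i ∈ Q, y i)
  unfold queueCost costBound
  rw [abs_le]
  constructor <;> linarith

theorem costBound_nonneg (hy : ∀ i ∈ C, 0 ≤ y i) : 0 ≤ costBound C y :=
  (abs_nonneg _).trans (abs_queueCost_le hy (Finset.Subset.refl C))

theorem neg_costBound_le_potential (hy : ∀ i ∈ C, 0 ≤ y i) {Q : Finset ι} (hQ : Q ⊆ C) (A : ℕ) :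
    -costBound C y ≤ potential C y A Q := by
  have h1 := (abs_le.mp (abs_queueCost_le hy hQ)).1
  have h2 : 0 ≤ ∑ i ∈ Q, y i := Finset.sum_nonneg fun i hi => hy i (hQ hi)
  have h3 : 0 ≤ (A : ℝ) * ∑ i ∈ Q, y i := by positivity
  unfold potential
  linarith

theorem potential_le (hy : ∀ i ∈ C, 0 ≤ y i) {Q : Finset ι} (hQ : Q ⊆ C) (A : ℕ) :
    potential C y A Q ≤ (∑ i ∈ C, y i) * A + costBound C y := by
  have h1 := (abs_le.mp (abs_queueCost_le hy hQ)).2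
  have h2 : ∑ i ∈ Q, y i ≤ ∑ i ∈ C, y i :=
    Finset.sum_le_sum_of_subset_of_nonneg hQ fun i hi _ => hy i hi
  have h3 : (A : ℝ) * ∑ i ∈ Q, y i ≤ A * ∑ i ∈ C, y i := by gcongr
  unfold potential
  linarith

theorem abs_potential_le (hy : ∀ i ∈ C, 0 ≤ y i) {Q : Finset ι} (hQ : Q ⊆ C) (A : ℕ) :
    |potential C y (A + 1) Q| ≤ (∑ i ∈ C, y i + costBound C y) * (A + 1) := by
  have h1 := neg_costBound_le_potential hy hQ (A + 1)
  have h2 := potential_le hy hQ (A + 1)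
  have h3 := costBound_nonneg hy
  have h4 : 0 ≤ ∑ i ∈ C, y i := Finset.sum_nonneg hy
  have h5 : (0 : ℝ) ≤ A := Nat.cast_nonneg A
  have h6 : 0 ≤ costBound C y * A := by positivity
  have h7 : 0 ≤ (∑ i ∈ C, y i) * A := by positivity
  push_cast at h2
  rw [abs_le]
  constructor <;> nlinarith

/-- Up to an error that occurs only if `r` is the oldest, but not the only oldest element, the
jump is inversely proportional to the rate of service. -/
theorem abs_jump_add_le [DecidableEq ι] (hy : ∀ i ∈ C, 1 ≤ y i) {a : ι → ℕ} {r i : ι} {t : ℕ}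
    (hr : r ∈ C) (hi : i ∈ C) (hmax : ∀ k ∈ C, a k ≤ a i)
    (htie : ∀ k ∈ C, k ≠ r → a k = a r → a r = t) :
    |(y i)⁻¹ * jump C y (a r) (ahead C a r) r i +
      (a r + ∑ k ∈ ahead C a r, y k - meanAge C y)| ≤
      (∑ i ∈ C, y i + costBound C y) * if a r = t then (t : ℝ) + 1 else 0 := by
  have hy0 : ∀ i ∈ C, 0 ≤ y i := fun i hi => zero_le_one.trans (hy i hi)
  have hyi : y i ≠ 0 := (zero_lt_one.trans_le (hy i hi)).ne'
  have hK : 0 ≤ ∑ i ∈ C, y i + costBound C y :=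
    add_nonneg (Finset.sum_nonneg hy0) (costBound_nonneg hy0)
  by_cases hir : i = r
  · subst hir
    have heq : (y i)⁻¹ * jump C y (a i) (ahead C a i) i i +
        (a i + ∑ k ∈ ahead C a i, y k - meanAge C y) =
        -((y i)⁻¹ * potential C y (a i + 1) ((ahead C a i).erase i)) := by
      rw [jump_self C y ((mem_ahead C).mpr ⟨hi, le_rfl⟩)]
      field_simp
      ring
    rw [heq, abs_neg, abs_mul, abs_of_nonneg (inv_nonneg.mpr (hy0 i hi))]
    have hsub : (ahead C a i).erase i ⊆ C :=
      (Finset.erase_subset _ _).trans (Finset.filter_subset _ _)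
    split_ifs with h
    · have h1 := abs_potential_le hy0 hsub (a i)
      have h2 : (y i)⁻¹ ≤ 1 := inv_le_one_of_one_le₀ (hy i hi)
      have h3 : 0 ≤ (y i)⁻¹ := inv_nonneg.mpr (hy0 i hi)
      rw [h] at h1 ⊢
      nlinarith [abs_nonneg (potential C y (t + 1) ((ahead C a i).erase i))]
    -- Without a tie, the oldest element is alone in its queue, so the error term is the potential
    -- of the empty set.
    · have : (ahead C a i).erase i = ∅ := by
        refine Finset.eq_empty_of_forall_notMem fun k hk => h ?_
        obtain ⟨hki, hk⟩ := Finset.mem_erase.mp hk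
        obtain ⟨hkC, hk⟩ := (mem_ahead C).mp hk
        exact htie k hkC hki (le_antisymm (hmax k hkC) hk)
      simp [this]
  · rw [jump_of_ne C y ((mem_ahead C).mpr ⟨hi, hmax r hr⟩) hir, mul_neg, inv_mul_cancel_left₀ hyi,
      neg_add_cancel, abs_zero]
    split_ifs <;> positivity

/-- The Lyapunov function of the initial phase, in which the set `U` has not been served. -/
theorem initial_step [DecidableEq ι] {a a' : ι → ℕ} {x : Finset ι} {t : ℕ} (ht : 1 ≤ t)
    (ha' : ∀ i ∈ C, a' i = if i ∈ x then 1 else a i + 1) (c : ℝ) :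
    c * ∑ i ∈ C with a' i = t + 1, y i = c * ∑ i ∈ C with a i = t, y i +
      ∑ i ∈ C, if i ∈ x then (if a i = t then -(c * y i) else 0) else 0 := by
  rw [Finset.sum_filter, Finset.sum_filter, Finset.mul_sum, Finset.mul_sum,
    ← Finset.sum_add_distrib]
  refine Finset.sum_congr rfl fun i hi => ?_
  rw [ha' i hi]
  have : t ≠ 0 := by omega
  by_cases h1 : i ∈ x <;> by_cases h2 : a i = t <;> simp [h1, h2, this]

end CyclicService

/-- If the increments of `f` are `D - a` up to a summable error and `f` is comparable to `a`, then
the averages of `a` tend to `D`. -/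
theorem tendsto_average_of_poisson {f a u : ℕ → ℝ} {D K B m b : ℝ} (hK : 0 ≤ K) (hm : 1 ≤ m)
    (hf : ∀ t, 1 ≤ t → |f (t + 1) - f t + a t - D| ≤ K * u t) (hu : ∀ t, 0 ≤ u t)
    (hB : ∀ T, ∑ t ∈ Finset.Icc 1 T, u t ≤ B) (hup : ∀ t, 1 ≤ t → f t ≤ m * a t + b)
    (hlow : ∀ t, 1 ≤ t → -b ≤ f t) :
    Tendsto (fun T : ℕ => (∑ t ∈ Finset.Icc 1 T, a t) / (T : ℝ)) atTop (nhds D) := by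
  have hm0 : 0 < m := zero_lt_one.trans_le hm
  have huB : ∀ t, 1 ≤ t → u t ≤ B := fun t ht =>
    (Finset.single_le_sum (f := u) (fun i _ => hu i) (Finset.mem_Icc.mpr ⟨ht, le_rfl⟩)).trans (hB t)
  -- `M` is invariant: a large `f t` forces `a t ≥ (f t - b) / m`, so `m * f (t + 1) ≤ (m - 1) * f t
  -- + b + m * (D + K * B)`.
  obtain ⟨M, hM1, hM2⟩ : ∃ M, f 1 ≤ M ∧ b + m * (D + K * B) ≤ M :=
    ⟨max _ _, le_max_left _ _, le_max_right _ _⟩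
  have hM : ∀ t, 1 ≤ t → f t ≤ M := by
    intro t ht
    induction t, ht using Nat.le_induction with
    | base => exact hM1
    | succ t ht ih =>
      have h1 := (abs_le.mp (hf t ht)).2
      have h2 := mul_le_mul_of_nonneg_left (huB t ht) hK
      have h3 := hup t ht
      have h4 : m * f (t + 1) ≤ m * (f t - a t + D + K * B) := by gcongr; linarith
      have h5 : (m - 1) * f t ≤ (m - 1) * M := mul_le_mul_of_nonneg_left ih (by linarith)
      have h6 : m * f (t + 1) ≤ m * M := by nlinarith
      exact le_of_mul_le_mul_left h6 hm0
  have hsum : ∀ T : ℕ, |f (T + 1) - f 1 + ∑ t ∈ Finset.Icc 1 T, a t - T * D| ≤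
      K * ∑ t ∈ Finset.Icc 1 T, u t := by
    intro T
    induction T with
    | zero => simp
    | succ T ih =>
      rw [Finset.sum_Icc_succ_top (by omega), Finset.sum_Icc_succ_top (by omega), mul_add]
      refine le_trans (le_of_eq ?_) ((abs_add_le _ _).trans (add_le_add ih (hf (T + 1) (by omega))))
      congr 1
      push_cast
      ring
  have hbound : ∀ T : ℕ, 1 ≤ T → |(∑ t ∈ Finset.Icc 1 T, a t) / (T : ℝ) - D| ≤
      (K * B + (|M| + |b| + |f 1|)) / T := by
    intro T hT
    have hT0 : (0 : ℝ) < T := by exact_mod_cast hT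
    rw [div_sub' hT0.ne', abs_div, abs_of_pos hT0]
    gcongr
    have h1 := abs_le.mp ((hsum T).trans (mul_le_mul_of_nonneg_left (hB T) hK))
    have h2 := hM (T + 1) (by omega)
    have h3 := hlow (T + 1) (by omega)
    have := le_abs_self M
    have := le_abs_self b
    have := abs_le.mp (le_refl |f 1|)
    have := abs_nonneg M
    have := abs_nonneg b
    rw [abs_le]
    constructor <;> linarith
  rw [tendsto_iff_norm_sub_tendsto_zero]
  refine squeeze_zero' (Eventually.of_forall fun _ => norm_nonneg _)
    (eventually_atTop.mpr ⟨1, fun T hT => hbound T hT⟩)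
    (tendsto_const_nhds.div_atTop tendsto_natCast_atTop_atTop)

/-! ### Service times of the requests -/

namespace QuantumSwitch

variable {N R : ℕ} (S : QuantumSwitch N R)

theorem v_pos (r : Fin R) : 0 < S.v r :=
  Finset.prod_pos fun i _ => unitInterval.coe_pos.mpr (S.p_pos i)

theorem v_le_one (r : Fin R) : S.v r ≤ 1 :=
  Finset.prod_le_one (fun i _ => (S.p i).2.1) fun i _ => (S.p i).2.2

theorem q_pos_of_mem {lam : ℕ} (hlam : lam ∈ S.cards) : 0 < (S.q lam : ℝ) := by
  obtain ⟨r, -, rfl⟩ := Finset.mem_image.mp hlam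
  exact unitInterval.coe_pos.mpr (S.q_pos r)

theorem C_nonempty {lam : ℕ} (hlam : lam ∈ S.cards) : (S.C lam).Nonempty := by
  obtain ⟨r, -, hr⟩ := Finset.mem_image.mp hlam
  exact ⟨r, by simp [C, hr]⟩

/-- The mean number of slots that request `i` of cardinality `lam` spends as the scheduled one,
when the cardinality is sampled with probability `s`. -/
noncomputable def serviceTime (lam : ℕ) (s : ℝ) (i : Fin R) : ℝ := (s * (S.q lam * S.v i))⁻¹

theorem one_le_serviceTime {lam : ℕ} (hlam : lam ∈ S.cards) {s : ℝ} (hs : 0 < s) (hs1 : s ≤ 1)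
    (i : Fin R) : 1 ≤ S.serviceTime lam s i := by
  have hq := S.q_pos_of_mem hlam
  have hv := S.v_pos i
  refine (one_le_inv₀ (by positivity)).mpr ?_
  exact mul_le_one₀ hs1 (by positivity) (mul_le_one₀ (S.q lam).2.2 hv.le (S.v_le_one i))

end QuantumSwitch

/-! ### Drift of the potential under an MMA policy, and the initial phase -/

namespace MMAPolicy

open CyclicService

variable {N R n : ℕ} (S : QuantumSwitch N R) (L : Fin n → Finset ℕ) (π : MMAPolicy N R n)

/-- The ages of all requests at slot `t`. -/
def ages (t : ℕ) (ω : ℕ → SlotNoise N R n) (i : Fin R) : ℕ := π.h S L i t ω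

theorem dependsOn_ages {β : Type*} (Φ : (Fin R → ℕ) → β) (t : ℕ) :
    DependsOn (fun ω => Φ (π.ages S L t ω)) (Set.Iio t) := by
  intro ω ω' hω
  have : π.ages S L t ω = π.ages S L t ω' := funext fun i => π.h_dependsOn S L i t hω
  simp only [this]

theorem integrable_ages (Φ : (Fin R → ℕ) → ℝ) (t : ℕ) :
    Integrable (fun ω => Φ (π.ages S L t ω)) (π.law S) :=
  π.integrable_of_dependsOn S (π.dependsOn_ages S L Φ t)

/-- The probability with which the cardinality `lam` is sampled. -/
noncomputable def rate (lam : ℕ) : ℝ := ∑ j with lam ∈ L j, (π.φ j).toReal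

theorem rate_nonneg (lam : ℕ) : 0 ≤ π.rate L lam :=
  Finset.sum_nonneg fun _ _ => ENNReal.toReal_nonneg

theorem sum_toReal : ∑ j, (π.φ j).toReal = 1 := by
  rw [← ENNReal.toReal_sum fun j _ => π.φ.apply_ne_top j, ← tsum_fintype (L := .unconditional _),
    π.φ.tsum_coe, ENNReal.toReal_one]

theorem rate_le_one (lam : ℕ) : π.rate L lam ≤ 1 := by
  rw [← π.sum_toReal]
  exact Finset.sum_le_sum_of_subset_of_nonneg (Finset.subset_univ _) fun _ _ _ =>
    ENNReal.toReal_nonneg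

variable {L}

theorem served_unique (hL : ∀ j, L j ⊆ S.cards) {lam t : ℕ} (ω : ℕ → SlotNoise N R n) :
    ∀ i ∈ S.C lam, ∀ k ∈ S.C lam, i ∈ π.served S L ω t → k ∈ π.served S L ω t → i = k := by
  intro i hi k hk h1 h2
  rw [π.mem_served_iff S hL hi] at h1
  rw [π.mem_served_iff S hL hk] at h2
  exact h1.2.1.symm.trans h2.2.1

variable (L) in
theorem ages_succ {t : ℕ} (ht : 1 ≤ t) (ω : ℕ → SlotNoise N R n) (i : Fin R) :
    π.ages S L (t + 1) ω i = if i ∈ π.served S L ω t then 1 else π.ages S L t ω i + 1 :=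
  QuantumSwitch.age_succ _ i ht

/-- The increment of the expected potential, up to an error that vanishes once all requests of the
cardinality have been served. -/
theorem abs_integral_potential_step_le (hL : ∀ j, L j ⊆ S.cards) {r : Fin R} {lam t : ℕ}
    (hr : r ∈ S.C lam) (hlam : lam ∈ S.cards) (hs : 0 < π.rate L lam) (ht : 1 ≤ t)
    {y : Fin R → ℝ} (hy : y = S.serviceTime lam (π.rate L lam)) :
    |∫ ω, potential (S.C lam) y (π.ages S L (t + 1) ω r)
          (ahead (S.C lam) (π.ages S L (t + 1) ω) r) ∂(π.law S) -
        ∫ ω, potential (S.C lam) y (π.ages S L t ω r)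
          (ahead (S.C lam) (π.ages S L t ω) r) ∂(π.law S) +
        ∫ ω, (π.ages S L t ω r : ℝ) ∂(π.law S) - meanAge (S.C lam) y| ≤
      (∑ i ∈ S.C lam, y i + costBound (S.C lam) y) *
        ∫ ω, (if ∃ i ∈ S.C lam, π.ages S L t ω i = t then (t : ℝ) + 1 else 0) ∂(π.law S) := by
  have hy1 : ∀ i ∈ S.C lam, 1 ≤ y i := fun i _ => by
    rw [hy]; exact S.one_le_serviceTime hlam hs (π.rate_le_one L lam) i
  have hy0 : ∀ i ∈ S.C lam, 0 ≤ y i := fun i hi => zero_le_one.trans (hy1 i hi)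
  have hK : 0 ≤ ∑ i ∈ S.C lam, y i + costBound (S.C lam) y :=
    add_nonneg (Finset.sum_nonneg hy0) (costBound_nonneg hy0)
  have hCy : ∑ i ∈ S.C lam, y i ≠ 0 :=
    (Finset.sum_pos (fun i hi => zero_lt_one.trans_le (hy1 i hi)) ⟨r, hr⟩).ne'
  have hstep : ∀ ω, potential (S.C lam) y (π.ages S L (t + 1) ω r)
      (ahead (S.C lam) (π.ages S L (t + 1) ω) r) = _ := fun ω =>
    potential_step (S.C lam) y hCy (a := π.ages S L t ω) (x := π.served S L ω t) hr
      (fun i _ => QuantumSwitch.one_le_age _ i ht) (fun i _ => π.ages_succ S L ht ω i)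
      (π.served_unique S hL ω)
  simp only [hstep]
  have hD1 := π.dependsOn_ages S L (fun a => potential (S.C lam) y (a r + 1) (ahead (S.C lam) a r)) t
  have hD2 := fun i => π.dependsOn_ages S L
    (fun a => jump (S.C lam) y (a r) (ahead (S.C lam) a r) r i) t
  rw [π.integral_step S hL hlam hD1 hD2]
  have hint1 := π.integrable_ages S L
    (fun a => potential (S.C lam) y (a r) (ahead (S.C lam) a r)) t
  have hint2 := π.integrable_ages S L (fun a => (a r : ℝ)) t
  have hint3 : Integrable (fun ω => potential (S.C lam) y (π.ages S L t ω r + 1)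
      (ahead (S.C lam) (π.ages S L t ω) r) + ∑ j with lam ∈ L j, (π.φ j).toReal *
        (S.q lam * S.v (π.candidate S L lam t j ω) *
          jump (S.C lam) y (π.ages S L t ω r) (ahead (S.C lam) (π.ages S L t ω) r) r
            (π.candidate S L lam t j ω))) (π.law S) :=
    π.integrable_of_dependsOn S (t := t) fun ω ω' hω => by
      have : π.ages S L t ω = π.ages S L t ω' := funext fun i => π.h_dependsOn S L i t hω
      simp only [this, π.candidate_dependsOn S L lam t _ hω]
  have hconst : meanAge (S.C lam) y = ∫ _, meanAge (S.C lam) y ∂(π.law S) := by simp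
  rw [hconst, ← integral_sub hint3 hint1, ← integral_add (hint3.sub' hint1) hint2,
    ← integral_sub ((hint3.sub' hint1).fun_add hint2) (integrable_const _),
    ← integral_const_mul, ← Real.norm_eq_abs]
  refine norm_integral_le_of_norm_le ((π.integrable_ages S L
    (fun a => if ∃ i ∈ S.C lam, a i = t then (t : ℝ) + 1 else 0) t).const_mul _)
    (Eventually.of_forall fun ω => ?_)
  -- Tie-breaking may depend on `j`, so the candidates may differ; the drift is a weighted mean over
  -- `j`, and the error bound holds for each candidate.
  have hrate : ∑ j with lam ∈ L j, (π.φ j).toReal / π.rate L lam = 1 := by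
    rw [← Finset.sum_div]
    exact div_self hs.ne'
  set a := π.ages S L t ω
  set E := (∑ i ∈ S.C lam, y i + costBound (S.C lam) y) *
    if ∃ i ∈ S.C lam, a i = t then (t : ℝ) + 1 else 0
  have herr : ∀ j, |(y (π.candidate S L lam t j ω))⁻¹ * jump (S.C lam) y (a r)
      (ahead (S.C lam) a r) r (π.candidate S L lam t j ω) +
      (a r + ∑ k ∈ ahead (S.C lam) a r, y k - meanAge (S.C lam) y)| ≤ E := by
    intro j
    have hmem := Finset.mem_filter.mp (π.candidate_mem_oldest S L hlam t j ω)
    refine (abs_jump_add_le hy1 (a := a) (t := t) hr hmem.1 hmem.2 ?_).trans ?_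
    · intro k hk hkr hka
      exact QuantumSwitch.age_eq_of_tie _ (fun t => π.served_unique S hL ω) ht hr hk hkr.symm
        hka.symm
    · refine mul_le_mul_of_nonneg_left ?_ hK
      by_cases h : a r = t
      · rw [if_pos h, if_pos ⟨r, hr, h⟩]
      · rw [if_neg h]
        split_ifs <;> positivity
  -- The growth of the age adds the sum of `y` over `ahead`; this cancels against the same sum in
  -- the jump and leaves `meanAge - a r`.
  have hsum : potential (S.C lam) y (a r + 1) (ahead (S.C lam) a r) +
      ∑ j with lam ∈ L j, (π.φ j).toReal * (S.q lam * S.v (π.candidate S L lam t j ω) *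
        jump (S.C lam) y (a r) (ahead (S.C lam) a r) r (π.candidate S L lam t j ω)) -
      potential (S.C lam) y (a r) (ahead (S.C lam) a r) + a r - meanAge (S.C lam) y =
      ∑ j with lam ∈ L j, (π.φ j).toReal / π.rate L lam *
        ((y (π.candidate S L lam t j ω))⁻¹ * jump (S.C lam) y (a r)
          (ahead (S.C lam) a r) r (π.candidate S L lam t j ω) +
          (a r + ∑ k ∈ ahead (S.C lam) a r, y k - meanAge (S.C lam) y)) := by
    simp only [mul_add (_ / _), Finset.sum_add_distrib]
    rw [← Finset.sum_mul, hrate]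
    have : ∀ j, (π.φ j).toReal / π.rate L lam * ((y (π.candidate S L lam t j ω))⁻¹ *
        jump (S.C lam) y (a r) (ahead (S.C lam) a r) r (π.candidate S L lam t j ω)) =
        (π.φ j).toReal * (S.q lam * S.v (π.candidate S L lam t j ω) *
        jump (S.C lam) y (a r) (ahead (S.C lam) a r) r (π.candidate S L lam t j ω)) := by
      intro j
      rw [hy, QuantumSwitch.serviceTime, inv_inv]
      field_simp
    simp only [this, potential]
    push_cast
    ring
  rw [Real.norm_eq_abs]
  refine (le_of_eq (congrArg abs hsum)).trans ((Finset.abs_sum_le_sum_abs _ _).trans ?_)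
  calc _ ≤ ∑ j with lam ∈ L j, (π.φ j).toReal / π.rate L lam * E := by
        refine Finset.sum_le_sum fun j _ => ?_
        rw [abs_mul, abs_of_nonneg (div_nonneg ENNReal.toReal_nonneg hs.le)]
        exact mul_le_mul_of_nonneg_left (herr j) (div_nonneg ENNReal.toReal_nonneg hs.le)
    _ = E := by rw [← Finset.sum_mul, hrate, one_mul]

/-- The initial phase, in which some request of the cardinality has not been served, is short. -/
theorem sum_initial_le (hL : ∀ j, L j ⊆ S.cards) {lam : ℕ} (hlam : lam ∈ S.cards)
    (hs : 0 < π.rate L lam) {y : Fin R → ℝ} (hy : y = S.serviceTime lam (π.rate L lam)) (T : ℕ) :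
    ∑ t ∈ Finset.Icc 1 T,
      ∫ ω, (if ∃ i ∈ S.C lam, π.ages S L t ω i = t then (t : ℝ) + 1 else 0) ∂(π.law S) ≤
      (1 + ∑ i ∈ S.C lam, y i) * ∑ i ∈ S.C lam, y i := by
  have hy0 : ∀ i ∈ S.C lam, 0 ≤ y i := fun i _ => by
    rw [hy]; exact zero_le_one.trans (S.one_le_serviceTime hlam hs (π.rate_le_one L lam) i)
  set m := ∑ i ∈ S.C lam, y i
  have hm : 0 ≤ m := Finset.sum_nonneg hy0
  -- With `Y` the sum of `y` over the requests never served, serving at rate `1 / y i` lowers `Y` by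
  -- 1 per slot on average while `Y > 0`. The weight `t + m` turns this into a decrease of at least
  -- `t + 1`, because `(t + 1 + m) * (Y - 1) ≤ (t + m) * Y - (t + 1)` when `Y ≤ m`.
  let g : ℕ → ℝ := fun t => ∫ ω, (t + m) * ∑ i ∈ S.C lam with π.ages S L t ω i = t, y i ∂(π.law S)
  have hg0 : ∀ t, 0 ≤ g t := fun t => integral_nonneg fun ω => mul_nonneg (by positivity)
    (Finset.sum_nonneg fun i hi => hy0 i (Finset.mem_filter.mp hi).1)
  have hstep : ∀ t, 1 ≤ t → g (t + 1) +
      ∫ ω, (if ∃ i ∈ S.C lam, π.ages S L t ω i = t then (t : ℝ) + 1 else 0) ∂(π.law S) ≤ g t := by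
    intro t ht
    have h1 : ∀ ω, ((t + 1 : ℕ) + m) * ∑ i ∈ S.C lam with π.ages S L (t + 1) ω i = t + 1, y i =
        _ := fun ω => initial_step (C := S.C lam) (y := y) (a := π.ages S L t ω)
          (x := π.served S L ω t) ht (fun i _ => π.ages_succ S L ht ω i) _
    simp only [g, h1]
    have hD1 := π.dependsOn_ages S L
      (fun a => ((t + 1 : ℕ) + m) * ∑ i ∈ S.C lam with a i = t, y i) t
    have hD2 := fun i => π.dependsOn_ages S L
      (fun a => if a i = t then -(((t + 1 : ℕ) + m) * y i) else 0) t
    have hint1 : Integrable (fun ω => ((t + 1 : ℕ) + m) *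
        ∑ i ∈ S.C lam with π.ages S L t ω i = t, y i + ∑ j with lam ∈ L j, (π.φ j).toReal *
        (S.q lam * S.v (π.candidate S L lam t j ω) *
          if π.ages S L t ω (π.candidate S L lam t j ω) = t then
            -(((t + 1 : ℕ) + m) * y (π.candidate S L lam t j ω)) else 0)) (π.law S) :=
      π.integrable_of_dependsOn S (t := t) fun ω ω' hω => by
        have : π.ages S L t ω = π.ages S L t ω' := funext fun i => π.h_dependsOn S L i t hω
        simp only [this, π.candidate_dependsOn S L lam t _ hω]
    have hint2 := π.integrable_ages S L
      (fun a => if ∃ i ∈ S.C lam, a i = t then (t : ℝ) + 1 else 0) t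
    rw [π.integral_step S hL hlam hD1 hD2, ← integral_add hint1 hint2]
    refine integral_mono (hint1.add hint2) (π.integrable_ages S L
      (fun a => (t + m) * ∑ i ∈ S.C lam with a i = t, y i) t) fun ω => ?_
    have hmax := fun j => (Finset.mem_filter.mp (π.candidate_mem_oldest S L hlam t j ω)).2
    have hmem := fun j => π.candidate_mem_C S L hlam t j ω
    have hle : ∀ i, π.ages S L t ω i ≤ t := fun i => QuantumSwitch.age_le _ i t
    by_cases hU : ∃ i ∈ S.C lam, π.ages S L t ω i = t
    · obtain ⟨i, hi, hit⟩ := hU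
      -- Age `t` is the largest possible, so a never-served request forces every candidate to be
      -- one.
      have hc : ∀ j, π.ages S L t ω (π.candidate S L lam t j ω) = t := fun j =>
        le_antisymm (hle _) (hit.symm.le.trans (hmax j i hi))
      have hterm : ∀ j, (π.φ j).toReal * (S.q lam * S.v (π.candidate S L lam t j ω) *
          -(((t + 1 : ℕ) + m) * y (π.candidate S L lam t j ω))) =
          (π.φ j).toReal * (-((t + 1 : ℕ) + m) / π.rate L lam) := by
        intro j
        have hq := S.q_pos_of_mem hlam
        have hv := S.v_pos (π.candidate S L lam t j ω)
        rw [hy, QuantumSwitch.serviceTime]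
        field_simp
      have hsub : ∑ i ∈ S.C lam with π.ages S L t ω i = t, y i ≤ m :=
        Finset.sum_le_sum_of_subset_of_nonneg (Finset.filter_subset _ _) fun i hi _ => hy0 i hi
      simp only [hc, if_true, hterm]
      rw [if_pos ⟨i, hi, hit⟩, ← Finset.sum_mul]
      change _ + π.rate L lam * _ + _ ≤ _
      rw [mul_div_cancel₀ _ hs.ne']
      push_cast
      linarith
    · have hc : ∀ j, π.ages S L t ω (π.candidate S L lam t j ω) ≠ t := fun j h =>
        hU ⟨_, hmem j, h⟩
      have hempty : (S.C lam).filter (fun i => π.ages S L t ω i = t) = ∅ :=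
        Finset.filter_eq_empty_iff.mpr fun i hi h => hU ⟨i, hi, h⟩
      simp [hc, hU, hempty]
  have hsum : ∀ T : ℕ, g (T + 1) + ∑ t ∈ Finset.Icc 1 T,
      ∫ ω, (if ∃ i ∈ S.C lam, π.ages S L t ω i = t then (t : ℝ) + 1 else 0) ∂(π.law S) ≤ g 1 := by
    intro T
    induction T with
    | zero => simp
    | succ T ih =>
      rw [Finset.sum_Icc_succ_top (by omega)]
      linarith [hstep (T + 1) (by omega)]
  have hg1 : g 1 = (1 + m) * m := by
    have : ∀ ω i, π.ages S L 1 ω i = 1 := fun ω i => QuantumSwitch.age_one _ i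
    simp [g, this, m]
  linarith [hsum T, hg0 (T + 1)]

end MMAPolicy

/-! ### Limits of the average ages and the value of the objective -/

namespace MMAPolicy

open CyclicService

variable {N R n : ℕ} (S : QuantumSwitch N R) {L : Fin n → Finset ℕ} (π : MMAPolicy N R n)

theorem tendsto_average_of_rate_pos (hL : ∀ j, L j ⊆ S.cards) {r : Fin R} {lam : ℕ}
    (hr : r ∈ S.C lam) (hlam : lam ∈ S.cards) (hs : 0 < π.rate L lam) :
    Tendsto (fun T : ℕ =>
      (∑ t ∈ Finset.Icc 1 T, ∫ ω, (π.ages S L t ω r : ℝ) ∂(π.law S)) / (T : ℝ)) atTop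
      (nhds (meanAge (S.C lam) (S.serviceTime lam (π.rate L lam)))) := by
  set y := S.serviceTime lam (π.rate L lam) with hy
  have hy1 : ∀ i ∈ S.C lam, 1 ≤ y i := fun i _ =>
    S.one_le_serviceTime hlam hs (π.rate_le_one L lam) i
  have hy0 : ∀ i ∈ S.C lam, 0 ≤ y i := fun i hi => zero_le_one.trans (hy1 i hi)
  have hK : 0 ≤ ∑ i ∈ S.C lam, y i + costBound (S.C lam) y :=
    add_nonneg (Finset.sum_nonneg hy0) (costBound_nonneg hy0)
  have hsub : ∀ t ω, ahead (S.C lam) (π.ages S L t ω) r ⊆ S.C lam := fun t ω =>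
    Finset.filter_subset _ _
  have hint := fun t => π.integrable_ages S L
    (fun a => potential (S.C lam) y (a r) (ahead (S.C lam) a r)) t
  refine tendsto_average_of_poisson (f := fun t => ∫ ω, potential (S.C lam) y (π.ages S L t ω r)
      (ahead (S.C lam) (π.ages S L t ω) r) ∂(π.law S)) hK
    ((hy1 r hr).trans (Finset.single_le_sum hy0 hr))
    (fun t ht => π.abs_integral_potential_step_le S hL hr hlam hs ht hy)
    (fun t => integral_nonneg fun ω => ?_) (fun T => π.sum_initial_le S hL hlam hs hy T)
    (b := costBound (S.C lam) y) (fun t _ => ?_) (fun t _ => ?_)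
  · dsimp only [Pi.zero_apply]
    split_ifs <;> positivity
  · have hint2 := π.integrable_ages S L (fun a => (∑ i ∈ S.C lam, y i) * (a r : ℝ)) t
    rw [← integral_const_mul, ← sub_le_iff_le_add, sub_eq_add_neg]
    have : ∫ ω, (potential (S.C lam) y (π.ages S L t ω r) (ahead (S.C lam) (π.ages S L t ω) r) +
        -costBound (S.C lam) y) ∂(π.law S) ≤
        ∫ ω, (∑ i ∈ S.C lam, y i) * (π.ages S L t ω r : ℝ) ∂(π.law S) :=
      integral_mono ((hint t).add (integrable_const _)) hint2 fun ω => by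
        have := potential_le hy0 (hsub t ω) (π.ages S L t ω r)
        dsimp only
        linarith
    rwa [integral_add (hint t) (integrable_const _), integral_const, probReal_univ, one_smul]
      at this
  · have : ∫ _, -costBound (S.C lam) y ∂(π.law S) ≤ ∫ ω, potential (S.C lam) y
        (π.ages S L t ω r) (ahead (S.C lam) (π.ages S L t ω) r) ∂(π.law S) :=
      integral_mono (integrable_const _) (hint t) fun ω =>
        neg_costBound_le_potential hy0 (hsub t ω) _
    rwa [integral_const, probReal_univ, one_smul] at this

theorem integral_ages_of_rate_zero (hL : ∀ j, L j ⊆ S.cards) {r : Fin R} {lam : ℕ}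
    (hr : r ∈ S.C lam) (hlam : lam ∈ S.cards) (hs : π.rate L lam = 0) {t : ℕ} (ht : 1 ≤ t) :
    ∫ ω, (π.ages S L t ω r : ℝ) ∂(π.law S) = t := by
  induction t, ht using Nat.le_induction with
  | base =>
    have : ∀ ω, π.ages S L 1 ω r = 1 := fun ω => QuantumSwitch.age_one _ r
    simp [this]
  | succ t ht ih =>
    have hstep : ∀ ω, (π.ages S L (t + 1) ω r : ℝ) = (π.ages S L t ω r + 1 : ℝ) +
        ∑ i ∈ S.C lam, if i ∈ π.served S L ω t then
          (if i = r then -(π.ages S L t ω r : ℝ) else 0) else 0 := by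
      intro ω
      rw [Finset.sum_eq_single r, π.ages_succ S L ht]
      · by_cases h : r ∈ π.served S L ω t <;> simp [h]
      · intro i _ hi
        simp [hi]
      · exact fun h => absurd hr h
    have hφ : ∀ j ∈ (Finset.univ.filter fun j => lam ∈ L j), (π.φ j).toReal = 0 :=
      (Finset.sum_eq_zero_iff_of_nonneg fun _ _ => ENNReal.toReal_nonneg).mp hs
    simp only [hstep]
    rw [π.integral_step S hL hlam (π.dependsOn_ages S L (fun a => (a r + 1 : ℝ)) t)
      (fun i => π.dependsOn_ages S L (fun a => if i = r then -(a r : ℝ) else 0) t)]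
    have : ∀ ω, ∑ j with lam ∈ L j, (π.φ j).toReal *
        (S.q lam * S.v (π.candidate S L lam t j ω) *
          if π.candidate S L lam t j ω = r then -(π.ages S L t ω r : ℝ) else 0) = 0 := fun ω =>
      Finset.sum_eq_zero fun j hj => by rw [hφ j hj, zero_mul]
    simp only [this, add_zero]
    rw [integral_add (π.integrable_ages S L (fun a => (a r : ℝ)) t) (integrable_const _), ih]
    simp

theorem expectedAge_eq (r : Fin R) (t : ℕ) :
    π.expectedAge S L r t = ENNReal.ofReal (∫ ω, (π.ages S L t ω r : ℝ) ∂(π.law S)) := by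
  rw [ofReal_integral_eq_lintegral_ofReal (π.integrable_ages S L (fun a => (a r : ℝ)) t)
    (Eventually.of_forall fun _ => Nat.cast_nonneg _)]
  simp [expectedAge, ages]

theorem average_expectedAge_eq (r : Fin R) {T : ℕ} (hT : 1 ≤ T) :
    (∑ t ∈ Finset.Icc 1 T, π.expectedAge S L r t) / (T : ℝ≥0∞) = ENNReal.ofReal
      ((∑ t ∈ Finset.Icc 1 T, ∫ ω, (π.ages S L t ω r : ℝ) ∂(π.law S)) / (T : ℝ)) := by
  rw [ENNReal.ofReal_div_of_pos (by exact_mod_cast hT), ENNReal.ofReal_natCast,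
    ENNReal.ofReal_sum_of_nonneg fun t _ => integral_nonneg fun ω => Nat.cast_nonneg _]
  simp only [expectedAge_eq]

/-- The service times are `(s * q)⁻¹` times `1 / v i`, and `meanAge` is homogeneous of degree 1 in
them. -/
theorem meanAge_serviceTime {lam : ℕ} (hlam : lam ∈ S.cards) {s : ℝ} (hs : 0 < s) :
    (S.C lam).card * meanAge (S.C lam) (S.serviceTime lam s) = s⁻¹ * S.w lam := by
  have hq := S.q_pos_of_mem hlam
  have hβ : 0 < S.β lam := Finset.sum_pos (fun i _ => one_div_pos.mpr (S.v_pos i))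
    (S.C_nonempty hlam)
  have h1 : ∑ i ∈ S.C lam, S.serviceTime lam s i = (s * S.q lam)⁻¹ * S.β lam := by
    rw [QuantumSwitch.β, Finset.mul_sum]
    refine Finset.sum_congr rfl fun i _ => ?_
    have := S.v_pos i
    rw [QuantumSwitch.serviceTime]
    field_simp
  have h2 : ∑ i ∈ S.C lam, S.serviceTime lam s i ^ 2 =
      (s * S.q lam)⁻¹ ^ 2 * ∑ i ∈ S.C lam, 1 / S.v i ^ 2 := by
    rw [Finset.mul_sum]
    refine Finset.sum_congr rfl fun i _ => ?_
    have := S.v_pos i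
    rw [QuantumSwitch.serviceTime]
    field_simp
  rw [meanAge, h1, h2, QuantumSwitch.w]
  field_simp
  ring

theorem w_pos {lam : ℕ} (hlam : lam ∈ S.cards) : 0 < S.w lam := by
  have hq := S.q_pos_of_mem hlam
  have hC := S.C_nonempty hlam
  have hβ : 0 < S.β lam := Finset.sum_pos (fun i _ => one_div_pos.mpr (S.v_pos i)) hC
  have h2 : 0 ≤ ∑ i ∈ S.C lam, 1 / S.v i ^ 2 := Finset.sum_nonneg fun i _ => by positivity
  have hcard : (0 : ℝ) < (S.C lam).card := by exact_mod_cast hC.card_pos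
  unfold QuantumSwitch.w
  positivity

theorem sum_phi_eq (lam : ℕ) :
    ∑ j with lam ∈ L j, π.φ j = ENNReal.ofReal (π.rate L lam) := by
  rw [rate, ENNReal.ofReal_sum_of_nonneg fun _ _ => ENNReal.toReal_nonneg]
  exact Finset.sum_congr rfl fun j _ => (ENNReal.ofReal_toReal (π.φ.apply_ne_top j)).symm

variable (L) in
/-- The limit of the average ages of the requests of cardinality `lam`. -/
noncomputable def limitAge (lam : ℕ) : ℝ≥0∞ :=
  1 / (∑ j with lam ∈ L j, π.φ j) * ENNReal.ofReal (S.w lam) / (S.C lam).card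

theorem limitAge_of_rate_pos {lam : ℕ} (hlam : lam ∈ S.cards) (hs : 0 < π.rate L lam) :
    π.limitAge S L lam =
      ENNReal.ofReal (meanAge (S.C lam) (S.serviceTime lam (π.rate L lam))) := by
  have hcard : (0 : ℝ) < (S.C lam).card := by exact_mod_cast (S.C_nonempty hlam).card_pos
  rw [limitAge, sum_phi_eq, one_div, ← ENNReal.ofReal_inv_of_pos hs,
    ← ENNReal.ofReal_mul (inv_nonneg.mpr hs.le), ← meanAge_serviceTime S hlam hs,
    ← ENNReal.ofReal_natCast, ← ENNReal.ofReal_div_of_pos hcard, mul_div_cancel_left₀ _ hcard.ne']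

theorem limitAge_of_rate_zero {lam : ℕ} (hlam : lam ∈ S.cards) (hs : π.rate L lam = 0) :
    π.limitAge S L lam = ⊤ := by
  rw [limitAge, sum_phi_eq, hs, ENNReal.ofReal_zero, one_div, ENNReal.inv_zero,
    ENNReal.top_mul (ENNReal.ofReal_pos.mpr (w_pos S hlam)).ne',
    ENNReal.top_div_of_ne_top (ENNReal.natCast_ne_top _)]

theorem tendsto_average_expectedAge (hL : ∀ j, L j ⊆ S.cards) {r : Fin R} {lam : ℕ}
    (hr : r ∈ S.C lam) (hlam : lam ∈ S.cards) :
    Tendsto (fun T : ℕ => (∑ t ∈ Finset.Icc 1 T, π.expectedAge S L r t) / (T : ℝ≥0∞)) atTop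
      (nhds (π.limitAge S L lam)) := by
  have heq : (fun T : ℕ => ENNReal.ofReal
      ((∑ t ∈ Finset.Icc 1 T, ∫ ω, (π.ages S L t ω r : ℝ) ∂(π.law S)) / (T : ℝ))) =ᶠ[atTop]
      fun T : ℕ => (∑ t ∈ Finset.Icc 1 T, π.expectedAge S L r t) / (T : ℝ≥0∞) :=
    eventually_atTop.mpr ⟨1, fun T hT => (π.average_expectedAge_eq S r hT).symm⟩
  refine Tendsto.congr' heq ?_
  rcases (π.rate_nonneg L lam).eq_or_lt with hs | hs
  · rw [π.limitAge_of_rate_zero S hlam hs.symm]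
    refine ENNReal.tendsto_ofReal_atTop.comp ?_
    have hsum : ∀ T : ℕ, ∑ t ∈ Finset.Icc 1 T, ∫ ω, (π.ages S L t ω r : ℝ) ∂(π.law S) =
        T * (T + 1) / 2 := by
      intro T
      induction T with
      | zero => simp
      | succ T ih =>
        rw [Finset.sum_Icc_succ_top (by omega), ih,
          π.integral_ages_of_rate_zero S hL hr hlam hs.symm (by omega)]
        push_cast
        ring
    -- The average is `(T + 1) / 2`, compared here with `T / 2`.
    refine tendsto_atTop_mono' atTop (eventually_atTop.mpr ⟨1, fun T hT => ?_⟩)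
      (tendsto_natCast_atTop_atTop.atTop_div_const (zero_lt_two (α := ℝ)))
    have hT0 : (0 : ℝ) < T := by exact_mod_cast hT
    dsimp only
    rw [hsum, le_div_iff₀ hT0]
    nlinarith
  · rw [π.limitAge_of_rate_pos S hlam hs]
    exact ENNReal.tendsto_ofReal (π.tendsto_average_of_rate_pos S hL hr hlam hs)

theorem card_mem_cards (r : Fin R) : (S.G r).card ∈ S.cards :=
  Finset.mem_image_of_mem _ (Finset.mem_univ r)

theorem sum_limitAge : ∑ r, π.limitAge S L (S.G r).card = samplingObjective S L π.φ := by
  rw [← Finset.sum_fiberwise_of_maps_to (t := S.cards) (fun r _ => card_mem_cards S r)]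
  refine Finset.sum_congr rfl fun lam hlam => ?_
  have h : ∀ r ∈ S.C lam, π.limitAge S L (S.G r).card = π.limitAge S L lam := fun r hr => by
    rw [(Finset.mem_filter.mp hr).2]
  refine (Finset.sum_congr rfl h).trans ?_
  rw [Finset.sum_const, nsmul_eq_mul, limitAge, ENNReal.mul_div_cancel
    (by exact_mod_cast (S.C_nonempty hlam).card_pos.ne') (ENNReal.natCast_ne_top _)]

theorem overallAge_eq (hL : ∀ j, L j ⊆ S.cards) :
    π.overallAge S L = samplingObjective S L π.φ / R := by
  rw [overallAge, ← sum_limitAge]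
  congr 1
  exact Finset.sum_congr rfl fun r _ => (π.tendsto_average_expectedAge S hL
    (by simp [QuantumSwitch.C]) (card_mem_cards S r)).limsup_eq

/-- The averages converge for every request, so the limit superior commutes with the finite sum and
both objectives agree. -/
theorem jointAge_eq (hL : ∀ j, L j ⊆ S.cards) :
    π.jointAge S L = samplingObjective S L π.φ / R := by
  have h := tendsto_finsetSum Finset.univ fun r _ => π.tendsto_average_expectedAge S hL
    (r := r) (by simp [QuantumSwitch.C]) (card_mem_cards S r)
  rw [sum_limitAge] at h
  rcases Nat.eq_zero_or_pos R with rfl | hR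
  · have := S.M_lt_sum
    simp at this
  have h2 := ENNReal.Tendsto.div_const h (b := (R : ℝ≥0∞)) (Or.inr (by exact_mod_cast hR.ne'))
  rw [jointAge, ← h2.limsup_eq]
  congr 1
  funext T
  simp only [div_eq_mul_inv, ← Finset.sum_mul]
  rw [ENNReal.mul_inv (Or.inr (ENNReal.natCast_ne_top _)) (Or.inl (ENNReal.natCast_ne_top _)),
    mul_assoc]

end MMAPolicy

/-! ### Minimizers of the sampling objective and optimal policies -/

theorem exists_isSamplingMinimizer {N R n : ℕ} (hn : 0 < n) (S : QuantumSwitch N R)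
    (L : Fin n → Finset ℕ) : ∃ φ : PMF (Fin n), IsSamplingMinimizer S L φ := by
  -- Inversion is continuous on `ℝ≥0∞` even at 0, so the objective is continuous up to the boundary
  -- of the simplex, where it may be infinite.
  have hcont : Continuous fun x : Fin n → ℝ => ∑ lam ∈ S.cards,
      (1 / (∑ i with lam ∈ L i, ENNReal.ofReal (x i))) * ENNReal.ofReal (S.w lam) := by
    refine continuous_finsetSum _ fun lam _ => ?_
    simp only [one_div]
    refine (ENNReal.continuous_mul_const ENNReal.ofReal_ne_top).comp (continuous_inv.comp ?_)
    exact continuous_finsetSum _ fun i _ => ENNReal.continuous_ofReal.comp (continuous_apply i)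
  have : Nonempty (Fin n) := ⟨⟨0, hn⟩⟩
  obtain ⟨x, hx, hmin⟩ := (isCompact_stdSimplex ℝ (Fin n)).exists_isMinOn
    ⟨_, single_mem_stdSimplex ℝ (Classical.arbitrary (Fin n))⟩ hcont.continuousOn
  refine ⟨PMF.ofFintype (fun i => ENNReal.ofReal (x i)) ?_, fun φ' => ?_⟩
  · rw [← ENNReal.ofReal_sum_of_nonneg fun i _ => hx.1 i, hx.2, ENNReal.ofReal_one]
  · have hmem : (fun i => (φ' i).toReal) ∈ stdSimplex ℝ (Fin n) := by
      refine ⟨fun i => ENNReal.toReal_nonneg, ?_⟩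
      rw [← ENNReal.toReal_sum fun j _ => φ'.apply_ne_top j,
        ← tsum_fintype (L := .unconditional _), φ'.tsum_coe, ENNReal.toReal_one]
    have h := isMinOn_iff.mp hmin _ hmem
    simp only [ENNReal.ofReal_toReal (φ'.apply_ne_top _)] at h
    exact h

/-- Every sampling distribution is that of some policy. -/
theorem MMAPolicy.exists_phi_eq {N R n : ℕ} (S : QuantumSwitch N R) (φ : PMF (Fin n)) :
    ∃ π : MMAPolicy N R n, π.φ = φ := by
  classical
  have : Nonempty (Fin R) := by
    rcases Nat.eq_zero_or_pos R with rfl | hR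
    · have := S.M_lt_sum
      simp at this
    · exact ⟨⟨0, hR⟩⟩
  refine ⟨⟨φ, fun _ _ _ _ A => if h : A.Nonempty then h.choose else Classical.arbitrary _,
    fun _ _ _ _ A h => ?_⟩, rfl⟩
  rw [dif_pos h]
  exact h.choose_spec

theorem mainTheorem5 {N R n : ℕ} (hn : 0 < n) (S : QuantumSwitch N R)
    (L : Fin n → Finset ℕ) (hL : ∀ i, S.IsMaximalFeasible (L i)) :
    (∃ π : MMAPolicy N R n, π.IsOptimal S L ∧ π.IsJointlyOptimal S L) ∧
      ∀ π : MMAPolicy N R n,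
        (π.IsOptimal S L ↔ IsSamplingMinimizer S L π.φ) ∧
          (π.IsJointlyOptimal S L ↔ IsSamplingMinimizer S L π.φ) := by
  have hsub : ∀ j, L j ⊆ S.cards := fun j => (hL j).1
  have hR : (R : ℝ≥0∞) ≠ 0 := by
    rcases Nat.eq_zero_or_pos R with rfl | hR
    · have := S.M_lt_sum
      simp at this
    · exact_mod_cast hR.ne'
  have hdiv : ∀ φ φ' : PMF (Fin n), samplingObjective S L φ / R ≤ samplingObjective S L φ' / R ↔
      samplingObjective S L φ ≤ samplingObjective S L φ' := fun φ φ' =>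
    ⟨fun h => by
      rwa [ENNReal.div_le_iff_le_mul (Or.inl hR) (Or.inl (ENNReal.natCast_ne_top R)),
        ENNReal.div_mul_cancel hR (ENNReal.natCast_ne_top R)] at h,
      fun h => ENNReal.div_le_div_right h _⟩
  -- Comparing with all policies amounts to comparing with all distributions, since each
  -- distribution is realized by a policy.
  have key : ∀ π : MMAPolicy N R n, (∀ π' : MMAPolicy N R n,
      samplingObjective S L π.φ ≤ samplingObjective S L π'.φ) ↔ IsSamplingMinimizer S L π.φ := by
    refine fun π => ⟨fun h φ' => ?_, fun h π' => h π'.φ⟩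
    obtain ⟨π', rfl⟩ := MMAPolicy.exists_phi_eq S φ'
    exact h π'
  have main : ∀ π : MMAPolicy N R n, (π.IsOptimal S L ↔ IsSamplingMinimizer S L π.φ) ∧
      (π.IsJointlyOptimal S L ↔ IsSamplingMinimizer S L π.φ) := fun π => by
    simp only [MMAPolicy.IsOptimal, MMAPolicy.IsJointlyOptimal, MMAPolicy.overallAge_eq S _ hsub,
      MMAPolicy.jointAge_eq S _ hsub, hdiv, key, and_self]
  obtain ⟨φ, hφ⟩ := exists_isSamplingMinimizer hn S L
  obtain ⟨π, rfl⟩ := MMAPolicy.exists_phi_eq S φ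
  exact ⟨⟨π, (main π).1.mpr hφ, (main π).2.mpr hφ⟩, main⟩
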